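/- Let $d\ge 1$, $\Omega=[0,1]^d$, let $\sigma(t)=t/(1+e^{-t})$ be the swish function (acting coordinatewise), and fix a depth $L\ge 1$, widths $d_0=d,d_1,\dots,d_L$ with $d_L=1$, and $B_\Theta>0$. Let $\mathcal F$ be the class of all functions $v(\cdot;\theta)=T_L\circ\sigma\circ T_{L-1}\circ\cdots\circ\sigma\circ T_1$ with $T_i(s)=A_is+B_i$, $A_i\in\mathbb R^{d_i\times d_{i-1}}$, $B_i\in\mathbb R^{d_i}$, where all entries of $\theta=\{(A_i,B_i)\}_{i=1}^L$ are at most $B_\Theta$ in absolute value. For points $X_1,\dots,X_n\in\Omega$ define, for the Poisson problem $-\Delta u=f$ with Neumann boundary condition, $$\mathcal L(u)=\int_\Omega\Big(\tfrac12\|\nabla u\|_2^2-fu\Big)dx+\tfrac12\Big(\int_\Omega u\,dx\Big)^2,\qquad \mathcal L_n(u)=\frac1n\sum_{j=1}^n\Big(\tfrac12\|\nabla u(X_j)\|_2^2-f(X_j)u(X_j)\Big)+\tfrac12\Big(\frac1n\sum_{j=1}^n u(X_j)\Big)^2,$$ and, for the static Schrödinger problem $-\Delta u+Vu=g$ with Neumann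 boundary condition, $$\mathcal L(u)=\int_\Omega\Big(\tfrac12\|\nabla u\|_2^2+\tfrac12V|u|^2-gu\Big)dx,\qquad \mathcal L_n(u)=\frac1n\sum_{j=1}^n\Big(\tfrac12\|\nabla u(X_j)\|_2^2-g(X_j)u(X_j)+\tfrac12V(X_j)|u(X_j)|^2\Big).$$ (i) Poisson. For every $M$ there is a constant $\lambda_1>0$, depending only on the network class $\mathcal F$ and on $M$, such that the following holds for every $f\in L^2(\Omega)$ with $\int_\Omega f\,dx=0$ and $|f|\le M$ almost everywhere in $\Omega$, and every $n\ge 2$. The functionals $\mathcal L$ and $\mathcal L_n$ attain their minima over $\mathcal F$. If $X_1,\dots,X_n$ are i.i.d. uniform random points of $\Omega$, $u_{\mathcal F}$ is any minimizer of $\mathcal L$ over $\mathcal F$, and $u_n$ is any (sample-dependent) choice of a minimizer of $\mathcal L_n$ over $\mathcal F$, then $$\mathbb E\big|\mathcal L(u_n)-\mathcal L_n(u_n)\big|\le\lambda_1 n^{-1/2}(\log n)^{1/2}\quad\text{and}\quad \mathbb E\big|\mathcal L(u_{\mathcal F})-\mathcal L_n(u_{\mathcal F})\big|\le\lambda_1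 n^{-1/2}(\log n)^{1/2}.$$ (ii) Schrödinger. For all $M$, $V_{\min}>0$ and $V_{\max}$ there is a constant $\lambda_2>0$, depending only on $\mathcal F$, $M$, $V_{\min}$, $V_{\max}$, such that the same conclusions, with $\lambda_2$ in place of $\lambda_1$, hold for the Schrödinger functionals for all $V,g\in L^\infty(\Omega)$ with $V_{\min}\le V\le V_{\max}$ and $|g|\le M$ almost everywhere in $\Omega$, and every $n\ge2$. Here, if the choice of $u_n$ makes $|\mathcal L(u_n)-\mathcal L_n(u_n)|$ non-measurable, its expectation is understood as the outer expectation (the infimum of the expectations of its measurable majorants). -/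

import Mathlib

open MeasureTheory
open scoped ENNReal Gradient Matrix

universe u

noncomputable section

/-- The closed unit cube `[0,1]^d` in Euclidean space. -/
def unitCube (d : ℕ) : Set (EuclideanSpace ℝ (Fin d)) :=
  {x | ∀ i, x i ∈ Set.Icc (0 : ℝ) 1}

/-- The swish activation function. -/
def swish (x : ℝ) : ℝ := x / (1 + Real.exp (-x))

/-- A network architecture: the depth is `hidden + 1`, and the layer widths are
`width 0` (the input dimension), `width 1`, ..., `width (hidden + 1) = 1`.
The values of `width` beyond `hidden + 1` are never used. -/
structure Architecture where
  hidden : ℕ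
  width : ℕ → ℕ
  width_out : width (hidden + 1) = 1

namespace Architecture

variable (N : Architecture)

/-- The dimension of the input. -/
abbrev inputDim : ℕ := N.width 0

/-- The weights: for each of the `hidden + 1` affine maps, its matrix and its shift vector. -/
abbrev Weights : Type :=
  ∀ i : Fin (N.hidden + 1),
    Matrix (Fin (N.width (i.val + 1))) (Fin (N.width i.val)) ℝ × (Fin (N.width (i.val + 1)) → ℝ)

/-- `N.preact θ x i` is `T_{i+1} ∘ σ ∘ T_i ∘ σ ∘ ⋯ ∘ σ ∘ T_1` at `x`, where `σ` (the swish
function) acts on each coordinate and `T_{i+1} s = (θ i).1 s + (θ i).2`. -/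
def preact (θ : N.Weights) (x : EuclideanSpace ℝ (Fin N.inputDim)) :
    ∀ i : ℕ, i < N.hidden + 1 → (Fin (N.width (i + 1)) → ℝ)
  | 0, h => (θ ⟨0, h⟩).1 *ᵥ (fun k => x k) + (θ ⟨0, h⟩).2
  | i + 1, h =>
      (θ ⟨i + 1, h⟩).1 *ᵥ (fun k => swish (preact θ x i (Nat.lt_of_succ_lt h) k))
        + (θ ⟨i + 1, h⟩).2

/-- The scalar function `v(· ; θ)` realized by the network with weights `θ`. -/
def realize (θ : N.Weights) (x : EuclideanSpace ℝ (Fin N.inputDim)) : ℝ :=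
  N.preact θ x N.hidden (Nat.lt_succ_self _) ⟨0, by rw [N.width_out]; exact Nat.one_pos⟩

/-- All entries of the weights are at most `B` in absolute value: `‖θ‖_∞ ≤ B`. -/
def WeightsBounded (B : ℝ) (θ : N.Weights) : Prop :=
  ∀ i, (∀ j k, |(θ i).1 j k| ≤ B) ∧ ∀ j, |(θ i).2 j| ≤ B

/-- The network class: all realizations with weights bounded by `B`. -/
def networkClass (B : ℝ) : Set (EuclideanSpace ℝ (Fin N.inputDim) → ℝ) :=
  {v | ∃ θ : N.Weights, N.WeightsBounded B θ ∧ v = N.realize θ}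

end Architecture

/-- The Ritz loss of the Neumann problem for the Poisson equation `-Δu = f`. -/
def poissonLoss {d : ℕ} (f u : EuclideanSpace ℝ (Fin d) → ℝ) : ℝ :=
  (∫ x in unitCube d, (1 / 2 * ‖∇ u x‖ ^ 2 - f x * u x))
    + 1 / 2 * (∫ x in unitCube d, u x) ^ 2

/-- The empirical Poisson loss at the sample points `x 0, ..., x (n - 1)`. -/
def poissonEmpLoss {d n : ℕ} (f : EuclideanSpace ℝ (Fin d) → ℝ)
    (x : Fin n → EuclideanSpace ℝ (Fin d)) (u : EuclideanSpace ℝ (Fin d) → ℝ) : ℝ :=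
  1 / (n : ℝ) * ∑ j, (1 / 2 * ‖∇ u (x j)‖ ^ 2 - f (x j) * u (x j))
    + 1 / 2 * (1 / (n : ℝ) * ∑ j, u (x j)) ^ 2

/-- The Ritz loss of the Neumann problem for the static Schrödinger equation `-Δu + Vu = g`. -/
def schrodingerLoss {d : ℕ} (V g u : EuclideanSpace ℝ (Fin d) → ℝ) : ℝ :=
  ∫ x in unitCube d, (1 / 2 * ‖∇ u x‖ ^ 2 + 1 / 2 * V x * |u x| ^ 2 - g x * u x)

/-- The empirical Schrödinger loss at the sample points `x 0, ..., x (n - 1)`. -/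
def schrodingerEmpLoss {d n : ℕ} (V g : EuclideanSpace ℝ (Fin d) → ℝ)
    (x : Fin n → EuclideanSpace ℝ (Fin d)) (u : EuclideanSpace ℝ (Fin d) → ℝ) : ℝ :=
  1 / (n : ℝ) * ∑ j, (1 / 2 * ‖∇ u (x j)‖ ^ 2 - g (x j) * u (x j)
    + 1 / 2 * V (x j) * |u (x j)| ^ 2)

/-- `u` is a minimizer of `J` over the class `F`. -/
def IsArgmin {α : Type*} (J : α → ℝ) (F : Set α) (u : α) : Prop :=
  u ∈ F ∧ ∀ v ∈ F, J u ≤ J v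

/-- `X 0, ..., X (n - 1)` are independent and uniformly distributed on the unit cube. -/
def IsIIDUniform {d n : ℕ} {S : Type*} [MeasurableSpace S] (P : Measure S)
    (X : Fin n → S → EuclideanSpace ℝ (Fin d)) : Prop :=
  ProbabilityTheory.iIndepFun X P ∧ ∀ j, pdf.IsUniform (X j) (unitCube d) P

/-- The outer expectation of a nonnegative function `h` (not necessarily measurable): the infimum
of the expectations of its measurable majorants. It is the expectation when `h` is measurable,
see `outerExpectation_eq_lintegral` and `outerExpectation_eq_integral`. -/
def outerExpectation {S : Type*} [MeasurableSpace S] (P : Measure S) (h : S → ℝ) : ℝ≥0∞ :=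
  ⨅ (Z : S → ℝ≥0∞) (_ : Measurable Z) (_ : ∀ ω, ENNReal.ofReal (h ω) ≤ Z ω), ∫⁻ ω, Z ω ∂P

theorem outerExpectation_eq_lintegral {S : Type*} [MeasurableSpace S] (P : Measure S)
    (h : S → ℝ) (hm : AEMeasurable h P) :
    outerExpectation P h = ∫⁻ ω, ENNReal.ofReal (h ω) ∂P := by
  unfold outerExpectation
  apply le_antisymm
  · have hm' : AEMeasurable (fun ω => ENNReal.ofReal (h ω)) P := hm.ennreal_ofReal
    obtain ⟨t, hts, htm, ht0⟩ := exists_measurable_superset_of_null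
      (ae_iff.1 hm'.ae_eq_mk)
    classical
    let Z : S → ℝ≥0∞ := t.piecewise (fun _ => ⊤) (hm'.mk _)
    have hZ : Measurable Z := measurable_const.piecewise htm hm'.measurable_mk
    have hle : ∀ ω, ENNReal.ofReal (h ω) ≤ Z ω := by
      intro ω
      by_cases hω : ω ∈ t
      · simp [Z, hω]
      · have : ENNReal.ofReal (h ω) = hm'.mk _ ω := by
          by_contra hne
          exact hω (hts hne)
        simp [Z, hω, ← this]
    refine le_trans (iInf_le _ Z) (le_trans (iInf_le _ hZ) (le_trans (iInf_le _ hle) (le_of_eq ?_)))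
    apply lintegral_congr_ae
    have h1 : ∀ᵐ ω ∂P, ω ∉ t := measure_eq_zero_iff_ae_notMem.1 ht0
    filter_upwards [h1, hm'.ae_eq_mk] with ω h1 h2
    simp [Z, h1, ← h2]
  · exact le_iInf fun Z => le_iInf fun _ => le_iInf fun hZ => lintegral_mono hZ

theorem outerExpectation_eq_integral {S : Type*} [MeasurableSpace S] (P : Measure S)
    (h : S → ℝ) (hi : Integrable h P) (h0 : ∀ ω, 0 ≤ h ω) :
    outerExpectation P h = ENNReal.ofReal (∫ ω, h ω ∂P) := by
  rw [outerExpectation_eq_lintegral P h hi.aemeasurable,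
    ofReal_integral_eq_lintegral_ofReal hi (Filter.Eventually.of_forall h0)]

end

/-! Everything follows from a uniform law of large numbers: the deviation between loss and empirical
loss, taken over the whole class, has a majorant with expectation of order √(log n / n). A minimizer
that depends on the sample is then as harmless as a fixed one. The class is the image of a sup-norm
ball of weight vectors in finite dimension p. As swish is smooth, the network and its squared
gradient norm are jointly smooth in weights and point, hence bounded and Lipschitz in the weights
over the cube. Factors f, g, V that are only measurable and bounded preserve this, outside a null
set independent of the weights (`IsBddLipFamily`). For such a family,
`IsBddLipFamily.exists_majorant` combines Hoeffding's exponential moments at t = √(n log n) with a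
sum over a grid of at most (n+1)^p weights; leaving the grid costs O(1/n). The majorant is an
explicit integrable function, so no measurability of a supremum is needed. The squared mean in the
Poisson loss reduces to the family of networks itself. Minimizers exist by compactness and
continuity. -/

/-! ### Bounded Lipschitz families. -/

/-- A family of functions indexed by a cube, which is uniformly bounded by `K` and uniformly
`Λ`-Lipschitz in the parameter, outside a common null set. -/
structure IsBddLipFamily {ι E : Type*} [Fintype ι] [MeasurableSpace E] (μ : Measure E)
    (R K Λ : ℝ) (h : (ι → ℝ) → E → ℝ) : Prop where
  bound_nonneg : 0 ≤ K
  lip_nonneg : 0 ≤ Λ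
  aemeasurable : ∀ θ, AEMeasurable (h θ) μ
  ae_bound : ∀ᵐ x ∂μ, ∀ θ ∈ Metric.closedBall 0 R, |h θ x| ≤ K
  ae_lip : ∀ᵐ x ∂μ, ∀ θ ∈ Metric.closedBall 0 R, ∀ θ' ∈ Metric.closedBall 0 R,
    |h θ x - h θ' x| ≤ Λ * dist θ θ'

namespace IsBddLipFamily

variable {ι E : Type*} [Fintype ι] [MeasurableSpace E] {μ : Measure E}
  {R K Λ K' Λ' : ℝ} {h h' : (ι → ℝ) → E → ℝ}

theorem add (hh : IsBddLipFamily μ R K Λ h) (hh' : IsBddLipFamily μ R K' Λ' h') :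
    IsBddLipFamily μ R (K + K') (Λ + Λ') (fun θ x => h θ x + h' θ x) where
  bound_nonneg := add_nonneg hh.bound_nonneg hh'.bound_nonneg
  lip_nonneg := add_nonneg hh.lip_nonneg hh'.lip_nonneg
  aemeasurable θ := (hh.aemeasurable θ).add (hh'.aemeasurable θ)
  ae_bound := by
    filter_upwards [hh.ae_bound, hh'.ae_bound] with x h1 h2 θ hθ
    exact (abs_add_le _ _).trans (add_le_add (h1 θ hθ) (h2 θ hθ))
  ae_lip := by
    filter_upwards [hh.ae_lip, hh'.ae_lip] with x h1 h2 θ hθ θ' hθ'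
    rw [add_sub_add_comm, add_mul]
    exact (abs_add_le _ _).trans (add_le_add (h1 θ hθ θ' hθ') (h2 θ hθ θ' hθ'))

theorem mul (hh : IsBddLipFamily μ R K Λ h) (hh' : IsBddLipFamily μ R K' Λ' h') :
    IsBddLipFamily μ R (K * K') (K * Λ' + Λ * K') (fun θ x => h θ x * h' θ x) where
  bound_nonneg := mul_nonneg hh.bound_nonneg hh'.bound_nonneg
  lip_nonneg := add_nonneg (mul_nonneg hh.bound_nonneg hh'.lip_nonneg)
    (mul_nonneg hh.lip_nonneg hh'.bound_nonneg)
  aemeasurable θ := (hh.aemeasurable θ).mul (hh'.aemeasurable θ)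
  ae_bound := by
    filter_upwards [hh.ae_bound, hh'.ae_bound] with x h1 h2 θ hθ
    rw [abs_mul]
    exact mul_le_mul (h1 θ hθ) (h2 θ hθ) (abs_nonneg _) hh.bound_nonneg
  ae_lip := by
    filter_upwards [hh.ae_bound, hh'.ae_bound, hh.ae_lip, hh'.ae_lip]
      with x b1 b2 h1 h2 θ hθ θ' hθ'
    have e : h θ x * h' θ x - h θ' x * h' θ' x
      = h θ x * (h' θ x - h' θ' x) + (h θ x - h θ' x) * h' θ' x := by ring
    rw [e]
    refine (abs_add_le _ _).trans ?_
    rw [abs_mul, abs_mul]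
    have t1 := mul_le_mul (b1 θ hθ) (h2 θ hθ θ' hθ') (abs_nonneg _) hh.bound_nonneg
    have t2 := mul_le_mul (h1 θ hθ θ' hθ') (b2 θ' hθ') (abs_nonneg _)
      (mul_nonneg hh.lip_nonneg dist_nonneg)
    linarith

/-- Lets the coefficients of the equation enter as factors: no regularity in x is needed, and the
Lipschitz constant in θ is zero. -/
theorem of_fixed {φ : E → ℝ} (hK : 0 ≤ K) (hφ : AEMeasurable φ μ) (hb : ∀ᵐ x ∂μ, |φ x| ≤ K) :
    IsBddLipFamily μ R K 0 (fun (_ : ι → ℝ) x => φ x) where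
  bound_nonneg := hK
  lip_nonneg := le_rfl
  aemeasurable _ := hφ
  ae_bound := by filter_upwards [hb] with x hx θ _ using hx
  ae_lip := by simp

theorem integrable [IsFiniteMeasure μ] (hh : IsBddLipFamily μ R K Λ h) {θ : ι → ℝ}
    (hθ : θ ∈ Metric.closedBall 0 R) : Integrable (h θ) μ := by
  refine Integrable.of_bound (hh.aemeasurable θ).aestronglyMeasurable K ?_
  filter_upwards [hh.ae_bound] with x hx using hx θ hθ

theorem abs_integral_le [IsProbabilityMeasure μ] (hh : IsBddLipFamily μ R K Λ h) {θ : ι → ℝ}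
    (hθ : θ ∈ Metric.closedBall 0 R) : |∫ x, h θ x ∂μ| ≤ K := by
  have := norm_integral_le_of_norm_le_const (μ := μ) (f := h θ) (C := K)
    (by filter_upwards [hh.ae_bound] with x hx using hx θ hθ)
  simpa using this

theorem abs_integral_sub_le [IsProbabilityMeasure μ] (hh : IsBddLipFamily μ R K Λ h)
    {θ θ' : ι → ℝ} (hθ : θ ∈ Metric.closedBall 0 R) (hθ' : θ' ∈ Metric.closedBall 0 R) :
    |∫ x, h θ x ∂μ - ∫ x, h θ' x ∂μ| ≤ Λ * dist θ θ' := by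
  rw [← integral_sub (hh.integrable hθ) (hh.integrable hθ')]
  have := norm_integral_le_of_norm_le_const (μ := μ) (f := fun x => h θ x - h θ' x)
    (C := Λ * dist θ θ') (by filter_upwards [hh.ae_lip] with x hx using hx θ hθ θ' hθ')
  simpa using this

theorem continuousOn_integral [IsProbabilityMeasure μ] (hh : IsBddLipFamily μ R K Λ h) :
    ContinuousOn (fun θ => ∫ x, h θ x ∂μ) (Metric.closedBall 0 R) := by
  refine LipschitzOnWith.continuousOn (K := ⟨Λ, hh.lip_nonneg⟩) ?_
  exact LipschitzOnWith.of_dist_le_mul fun θ hθ θ' hθ' => hh.abs_integral_sub_le hθ hθ'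

/-- A jointly `C¹` family is bounded and Lipschitz on a compact convex set. -/
theorem of_contDiff {F : Type*} [NormedAddCommGroup F] [NormedSpace ℝ F] [MeasurableSpace F]
    [BorelSpace F] {s : Set F} (hs : IsCompact s) (hsc : Convex ℝ s) (ν : Measure F) (R : ℝ)
    {a : (ι → ℝ) → F → ℝ} (ha : ContDiff ℝ 1 (Function.uncurry a)) :
    ∃ K Λ, IsBddLipFamily (ν.restrict s) R K Λ a := by
  have hcpt : IsCompact (Metric.closedBall (0 : ι → ℝ) R ×ˢ s) :=
    (isCompact_closedBall _ _).prod hs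
  obtain ⟨C, hC⟩ := hcpt.exists_bound_of_continuousOn ha.continuous.continuousOn
  obtain ⟨Λ, hΛ⟩ := ha.contDiffOn.exists_lipschitzOnWith one_ne_zero
    ((convex_closedBall (0 : ι → ℝ) R).prod hsc) hcpt
  have hmem : ∀ᵐ x ∂(ν.restrict s), x ∈ s := ae_restrict_mem₀ hs.measurableSet.nullMeasurableSet
  refine ⟨max C 0, Λ, le_max_right _ _, Λ.2, fun θ => ?_, ?_, ?_⟩
  · have : Continuous (a θ) := ha.continuous.comp (Continuous.prodMk_right θ)
    exact this.measurable.aemeasurable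
  · filter_upwards [hmem] with x hx θ hθ
    exact (hC (θ, x) ⟨hθ, hx⟩).trans (le_max_left _ _)
  · filter_upwards [hmem] with x hx θ hθ θ' hθ'
    -- Both points share x, so their distance in the product is `dist θ θ'`.
    have := hΛ.dist_le_mul (θ, x) ⟨hθ, hx⟩ (θ', x) ⟨hθ', hx⟩
    simpa [Prod.dist_eq, Real.dist_eq] using this

end IsBddLipFamily

/-! ### Covering and concentration. -/

/-- A cube of side `2R` is covered by the `2R/m`-balls around `(m+1)^p` grid points. -/
theorem exists_grid_net {ι : Type*} [Fintype ι] {R : ℝ} (hR : 0 < R) {m : ℕ} (hm : 0 < m) :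
    ∃ s : Finset (ι → ℝ), s.card ≤ (m + 1) ^ Fintype.card ι ∧
      (∀ θ ∈ s, θ ∈ Metric.closedBall 0 R) ∧
      ∀ θ ∈ Metric.closedBall (0 : ι → ℝ) R, ∃ θ' ∈ s, dist θ θ' ≤ 2 * R / m := by
  classical
  have hm' : (0 : ℝ) < m := by exact_mod_cast hm
  let g : (ι → Fin (m + 1)) → ι → ℝ := fun k i => -R + 2 * R / m * (k i : ℕ)
  refine ⟨Finset.univ.image g, ?_, ?_, ?_⟩
  · refine Finset.card_image_le.trans ?_
    simp
  · intro θ hθ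
    obtain ⟨k, -, rfl⟩ := Finset.mem_image.1 hθ
    rw [mem_closedBall_zero_iff, pi_norm_le_iff_of_nonneg hR.le]
    intro i
    have h1 : ((k i : ℕ) : ℝ) ≤ m := by exact_mod_cast Nat.lt_succ_iff.1 (k i).2
    have h2 : 2 * R / m * (k i : ℕ) ≤ 2 * R / m * m := by gcongr
    have h3 : 0 ≤ 2 * R / m * ((k i : ℕ) : ℝ) := by positivity
    rw [div_mul_cancel₀ _ hm'.ne'] at h2
    rw [Real.norm_eq_abs, abs_le]
    constructor <;> simp only [g] <;> linarith
  · intro θ hθ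
    rw [mem_closedBall_zero_iff, pi_norm_le_iff_of_nonneg hR.le] at hθ
    have hb : ∀ i, 0 ≤ (θ i + R) * m / (2 * R) ∧ (θ i + R) * m / (2 * R) ≤ m := by
      intro i
      have := abs_le.1 (hθ i)
      constructor
      · have : 0 ≤ θ i + R := by linarith
        positivity
      · rw [div_le_iff₀ (by positivity), mul_comm]
        gcongr
        linarith
    -- Rounding each coordinate down to the grid moves it by at most one mesh width; the value m is
    -- attained at the right end, hence m + 1 nodes per axis.
    refine ⟨g fun i => ⟨⌊(θ i + R) * m / (2 * R)⌋₊,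
      Nat.lt_succ_of_le (Nat.floor_le_of_le (hb i).2)⟩,
      Finset.mem_image_of_mem _ (Finset.mem_univ _), ?_⟩
    rw [dist_pi_le_iff (by positivity)]
    intro i
    have h1 := Nat.floor_le (hb i).1
    have h2 := (Nat.lt_floor_add_one ((θ i + R) * m / (2 * R))).le
    have e : 2 * R / m * ((θ i + R) * m / (2 * R)) = θ i + R := by field_simp
    have hp : 0 ≤ 2 * R / m := by positivity
    have h3 := mul_le_mul_of_nonneg_left h1 hp
    have h4 := mul_le_mul_of_nonneg_left h2 hp
    rw [e] at h3 h4
    rw [Real.dist_eq, abs_le]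
    constructor <;> simp only [g] <;> linarith

theorem abs_average_le {n : ℕ} (hn : 0 < n) {a : Fin n → ℝ} {C : ℝ} (ha : ∀ j, |a j| ≤ C) :
    |1 / (n : ℝ) * ∑ j, a j| ≤ C := by
  have hn' : (0 : ℝ) < n := by exact_mod_cast hn
  rw [abs_mul, abs_of_pos (by positivity), one_div, inv_mul_le_iff₀ hn']
  refine (Finset.abs_sum_le_sum_abs _ _).trans ((Finset.sum_le_sum fun j _ => ha j).trans ?_)
  simp

/-- Hoeffding's bound for the exponential moments of the deviation of an empirical mean. -/
theorem exp_moment_deviation {E S : Type*} [MeasurableSpace E] [MeasurableSpace S]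
    {μ : Measure E} {P : Measure S} [IsProbabilityMeasure P] {n : ℕ} (hn : 0 < n)
    {X : Fin n → S → E} (hind : ProbabilityTheory.iIndepFun X P)
    (hX : ∀ j, AEMeasurable (X j) P) (hlaw : ∀ j, P.map (X j) = μ)
    {φ : E → ℝ} (hφ : AEMeasurable φ μ) {K : ℝ} (hb : ∀ᵐ x ∂μ, |φ x| ≤ K) (t : ℝ) :
    Integrable (fun ω => Real.exp (t * (∫ x, φ x ∂μ - 1 / (n : ℝ) * ∑ j, φ (X j ω)))) P ∧
    ∫ ω, Real.exp (t * (∫ x, φ x ∂μ - 1 / (n : ℝ) * ∑ j, φ (X j ω))) ∂P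
      ≤ Real.exp (K ^ 2 * t ^ 2 / (2 * n)) := by
  have hn' : (0 : ℝ) < n := by exact_mod_cast hn
  have hind' : ProbabilityTheory.iIndepFun (fun j ω => φ (X j ω) - ∫ x, φ x ∂μ) P :=
    hind.comp₀ (fun _ x => φ x - ∫ x, φ x ∂μ) hX fun j => by
      rw [hlaw j]; exact hφ.sub_const _
  -- Hoeffding's lemma on [-K, K]: variance proxy (2K/2)² = K² per summand.
  have hsub : ∀ j, ProbabilityTheory.HasSubgaussianMGF
      (fun ω => φ (X j ω) - ∫ x, φ x ∂μ) ((‖K - -K‖₊ / 2) ^ 2) P := by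
    intro j
    have hφ' : AEMeasurable φ (P.map (X j)) := by rw [hlaw j]; exact hφ
    have h1 := ProbabilityTheory.hasSubgaussianMGF_of_mem_Icc (a := -K) (b := K)
      (hφ'.comp_aemeasurable (hX j)) (by
        have := ae_of_ae_map (hX j) (by rw [hlaw j]; exact hb)
        filter_upwards [this] with ω hω using abs_le.1 hω)
    have h2 : ∫ ω, (φ ∘ X j) ω ∂P = ∫ x, φ x ∂μ := by
      rw [← hlaw j, integral_map (hX j) hφ'.aestronglyMeasurable]; rfl
    rw [h2] at h1
    exact h1
  have hsum := ProbabilityTheory.HasSubgaussianMGF.sum_of_iIndepFun hind' (s := Finset.univ)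
    (fun j _ => hsub j)
  have e : ∀ ω, t * (∫ x, φ x ∂μ - 1 / (n : ℝ) * ∑ j, φ (X j ω))
      = (-t / n) * ∑ j, (φ (X j ω) - ∫ x, φ x ∂μ) := by
    intro ω
    simp only [Finset.sum_sub_distrib, Finset.sum_const, Finset.card_univ, Fintype.card_fin,
      nsmul_eq_mul]
    field_simp
    ring
  simp only [e]
  refine ⟨hsum.integrable_exp_mul _, (hsum.mgf_le (-t / n)).trans (le_of_eq ?_)⟩
  congr 1
  have : ((∑ j : Fin n, (‖K - -K‖₊ / 2) ^ 2 : NNReal) : ℝ) = n * K ^ 2 := by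
    simp [← two_mul]
  rw [this]
  field_simp

/-! ### The rate and the uniform deviation bound. -/

/-- The convergence rate `√(log n / n)`. -/
noncomputable def logRate (n : ℕ) : ℝ := (n : ℝ) ^ (-(1 / 2) : ℝ) * Real.log n ^ (1 / 2 : ℝ)

theorem half_le_log {n : ℕ} (hn : 2 ≤ n) : 1 / 2 ≤ Real.log n := by
  have : Real.log 2 ≤ Real.log n := Real.log_le_log (by norm_num) (by exact_mod_cast hn)
  linarith [Real.log_two_gt_d9]

theorem logRate_pos {n : ℕ} (hn : 2 ≤ n) : 0 < logRate n := by
  have := half_le_log hn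
  have hn' : (0 : ℝ) < n := by positivity
  exact mul_pos (Real.rpow_pos_of_pos hn' _) (Real.rpow_pos_of_pos (by linarith) _)

theorem logRate_sq {n : ℕ} (hn : 2 ≤ n) : logRate n ^ 2 = Real.log n / n := by
  have := half_le_log hn
  have hn' : (0 : ℝ) < n := by positivity
  rw [logRate, mul_pow, ← Real.rpow_natCast, ← Real.rpow_natCast, ← Real.rpow_mul hn'.le,
    ← Real.rpow_mul (by linarith)]
  norm_num [Real.rpow_neg_one]
  field_simp

/-- Absorbs the discretization error into the rate; after squaring it says n log n ≥ 1, which holds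
from n = 2 on. -/
theorem inv_le_logRate {n : ℕ} (hn : 2 ≤ n) : 1 / (n : ℝ) ≤ logRate n := by
  have h1 := half_le_log hn
  have h2 : (2 : ℝ) ≤ n := by exact_mod_cast hn
  refine (sq_le_sq₀ (by positivity) (logRate_pos hn).le).1 ?_
  rw [logRate_sq hn, div_pow, div_le_div_iff₀ (by positivity) (by positivity)]
  nlinarith

/-- Uniform deviation of empirical means over a bounded Lipschitz family: an integrable majorant
whose expectation is of order `√(log n / n)`. -/
theorem IsBddLipFamily.exists_majorant {ι E S : Type*} [Fintype ι] [MeasurableSpace E]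
    [MeasurableSpace S] {μ : Measure E} [IsProbabilityMeasure μ] {R K Λ : ℝ}
    {h : (ι → ℝ) → E → ℝ} (hh : IsBddLipFamily μ R K Λ h) (hR : 0 < R)
    {P : Measure S} [IsProbabilityMeasure P] {n : ℕ} (hn : 2 ≤ n)
    {X : Fin n → S → E} (hind : ProbabilityTheory.iIndepFun X P)
    (hX : ∀ j, AEMeasurable (X j) P) (hlaw : ∀ j, P.map (X j) = μ) :
    ∃ Z : S → ℝ, Integrable Z P ∧
      (∀ᵐ ω ∂P, ∀ θ ∈ Metric.closedBall 0 R,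
        |∫ x, h θ x ∂μ - 1 / (n : ℝ) * ∑ j, h θ (X j ω)| ≤ Z ω) ∧
      ∫ ω, Z ω ∂P ≤ (4 * Λ * R + (1 + 2 * Fintype.card ι + K ^ 2 / 2)) * logRate n := by
  have hn0 : 0 < n := by omega
  have hn' : (0 : ℝ) < n := by positivity
  have hlog := half_le_log hn
  have hr := logRate_pos hn
  set r := logRate n
  have hr2 : n * r ^ 2 = Real.log n := by rw [logRate_sq hn]; field_simp
  set p : ℝ := (Fintype.card ι : ℝ)
  -- With this t, t²/n = log n, so each Hoeffding moment is at most n^(K²/2).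
  set t : ℝ := n * r with ht_def
  have ht : 0 < t := by positivity
  -- Chosen so that exp A = n · n^(2p) · n^(K²/2) bounds the expectation of `W`: the factor 2 for
  -- the two signs is at most n, and the grid has at most (n+1)^p ≤ n^(2p) points.
  set A : ℝ := (1 + 2 * p + K ^ 2 / 2) * Real.log n with hA
  obtain ⟨s, hcard, hsub, hnet⟩ := exists_grid_net (ι := ι) hR hn0
  let D : (ι → ℝ) → S → ℝ := fun θ ω => ∫ x, h θ x ∂μ - 1 / (n : ℝ) * ∑ j, h θ (X j ω)
  have hexp : ∀ θ ∈ s, ∀ τ : ℝ, Integrable (fun ω => Real.exp (τ * D θ ω)) P ∧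
      ∫ ω, Real.exp (τ * D θ ω) ∂P ≤ Real.exp (K ^ 2 * τ ^ 2 / (2 * n)) := fun θ hθ τ =>
    exp_moment_deviation hn0 hind hX hlaw (hh.aemeasurable θ)
      (by filter_upwards [hh.ae_bound] with x hx using hx θ (hsub θ hθ)) τ
  let W : S → ℝ := fun ω => ∑ θ ∈ s, (Real.exp (t * D θ ω) + Real.exp (-t * D θ ω))
  have hterm : ∀ θ ∈ s,
      Integrable (fun ω => Real.exp (t * D θ ω) + Real.exp (-t * D θ ω)) P :=
    fun θ hθ => (hexp θ hθ t).1.add (hexp θ hθ (-t)).1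
  have hW : Integrable W P := integrable_finsetSum _ hterm
  have hV : Integrable (fun ω => A - 1 + Real.exp (-A) * W ω) P :=
    (integrable_const _).add (hW.const_mul _)
  have hWle : ∫ ω, W ω ∂P ≤ Real.exp A := by
    have h1 : ∫ ω, W ω ∂P ≤ ∑ θ ∈ s, 2 * Real.exp (K ^ 2 / 2 * Real.log n) := by
      simp only [W]
      rw [integral_finsetSum _ hterm]
      refine Finset.sum_le_sum fun θ hθ => ?_
      rw [integral_add (hexp θ hθ t).1 (hexp θ hθ (-t)).1]
      have e1 := (hexp θ hθ t).2
      have e2 := (hexp θ hθ (-t)).2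
      have e3 : K ^ 2 * t ^ 2 / (2 * n) = K ^ 2 / 2 * Real.log n := by
        rw [← hr2, ht_def]; field_simp
      rw [neg_sq, e3] at e2
      rw [e3] at e1
      linarith
    rw [Finset.sum_const, nsmul_eq_mul] at h1
    refine h1.trans ?_
    have h2 : (s.card : ℝ) ≤ Real.exp (2 * p * Real.log n) := by
      have : (s.card : ℝ) ≤ ((n : ℝ) + 1) ^ Fintype.card ι := by exact_mod_cast hcard
      refine this.trans ?_
      have e : Real.exp (2 * p * Real.log n) = ((n : ℝ) ^ 2) ^ Fintype.card ι := by
        rw [show 2 * p * Real.log n = (Fintype.card ι : ℝ) * ((2 : ℕ) * Real.log n) by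
          simp only [p]; push_cast; ring, Real.exp_nat_mul, Real.exp_nat_mul, Real.exp_log hn']
      rw [e]
      have h2 : (2 : ℝ) ≤ n := by exact_mod_cast hn
      gcongr
      nlinarith
    have h3 : (2 : ℝ) ≤ Real.exp (Real.log n) := by
      rw [Real.exp_log hn']; exact_mod_cast hn
    have e : Real.exp A = Real.exp (2 * p * Real.log n) *
        (Real.exp (Real.log n) * Real.exp (K ^ 2 / 2 * Real.log n)) := by
      rw [← Real.exp_add, ← Real.exp_add, hA]; ring_nf
    rw [e]
    gcongr
  -- The first term is the cost 2ΛR/n of moving to the grid, paid once for the integral and once for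
  -- the empirical mean. The second replaces (log W)/t by the tangent of log at exp A, which is
  -- affine in `W` and so easy to integrate.
  refine ⟨fun ω => 4 * Λ * R * (1 / n) + 1 / t * (A - 1 + Real.exp (-A) * W ω), ?_, ?_, ?_⟩
  · exact (integrable_const _).add (hV.const_mul _)
  · have hlip : ∀ᵐ ω ∂P, ∀ j, ∀ θ ∈ Metric.closedBall 0 R, ∀ θ' ∈ Metric.closedBall 0 R,
        |h θ (X j ω) - h θ' (X j ω)| ≤ Λ * dist θ θ' :=
      ae_all_iff.2 fun j => ae_of_ae_map (hX j) (by rw [hlaw j]; exact hh.ae_lip)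
    filter_upwards [hlip] with ω hω θ hθ
    obtain ⟨θ', hθ', hd⟩ := hnet θ hθ
    have h1 := hh.abs_integral_sub_le hθ (hsub θ' hθ')
    have h2 := abs_average_le hn0 fun j => hω j θ hθ θ' (hsub θ' hθ')
    rw [Finset.sum_sub_distrib, mul_sub] at h2
    have hd' : Λ * dist θ θ' ≤ 2 * Λ * R * (1 / n) :=
      (mul_le_mul_of_nonneg_left hd hh.lip_nonneg).trans (le_of_eq (by ring))
    have h3 : t * |D θ' ω| ≤ A - 1 + Real.exp (-A) * W ω := by
      have e1 : Real.exp (t * |D θ' ω|) ≤ W ω := by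
        refine le_trans ?_ (Finset.single_le_sum (f := fun θ => Real.exp (t * D θ ω)
          + Real.exp (-t * D θ ω)) (fun _ _ => by positivity) hθ')
        rcases abs_choice (D θ' ω) with h | h <;> rw [h]
        · linarith [Real.exp_pos (-t * D θ' ω)]
        · rw [mul_neg, ← neg_mul]
          linarith [Real.exp_pos (t * D θ' ω)]
      -- The tangent inequality x ≤ A - 1 + exp(-A) exp x, at x = t|D|.
      have e2 := Real.add_one_le_exp (-A + t * |D θ' ω|)
      rw [Real.exp_add] at e2
      have e3 := mul_le_mul_of_nonneg_left e1 (Real.exp_pos (-A)).le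
      linarith
    have h4 : |D θ' ω| ≤ 1 / t * (A - 1 + Real.exp (-A) * W ω) := by
      rw [one_div, le_inv_mul_iff₀ ht]; exact h3
    have h5 := abs_le.1 h4
    have h6 := abs_le.1 h1
    have h7 := abs_le.1 h2
    simp only [D] at h5
    rw [abs_le]
    constructor <;> linarith
  · rw [integral_add (integrable_const _) (hV.const_mul _), integral_const_mul (1 / t),
      integral_add (integrable_const _) (hW.const_mul _), integral_const_mul (Real.exp (-A))]
    simp only [integral_const, probReal_univ, one_smul]
    -- This cancels the -1, leaving A/t, which is a constant times the rate.
    have h1 : Real.exp (-A) * ∫ ω, W ω ∂P ≤ 1 := by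
      rw [Real.exp_neg, inv_mul_le_iff₀ (Real.exp_pos _), mul_one]; exact hWle
    have h2 : 1 / t * (A - 1 + Real.exp (-A) * ∫ ω, W ω ∂P) ≤ 1 / t * A := by
      gcongr; linarith
    have h3 : 1 / t * A = (1 + 2 * p + K ^ 2 / 2) * r := by
      rw [hA, ← hr2, ht_def]; field_simp
    have h4 : 4 * Λ * R * (1 / n) ≤ 4 * Λ * R * r :=
      mul_le_mul_of_nonneg_left (inv_le_logRate hn)
        (mul_nonneg (mul_nonneg (by norm_num) hh.lip_nonneg) hR.le)
    linarith

/-! ### Smoothness of networks in weights and input. -/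

theorem contDiff_swish {n : WithTop ℕ∞} : ContDiff ℝ n swish := by
  unfold swish
  exact contDiff_id.div (contDiff_const.add (Real.contDiff_exp.comp contDiff_neg))
    fun x => (by positivity : (0 : ℝ) < 1 + Real.exp (-x)).ne'

namespace Architecture

variable (N : Architecture)

/-- The index set of the scalar weights of a network. -/
abbrev WeightIndex : Type :=
  Σ i : Fin (N.hidden + 1),
    (Fin (N.width (i.val + 1)) × Fin (N.width i.val)) ⊕ Fin (N.width (i.val + 1))

/-- The weights assembled from a vector of scalars. -/
def toWeights (η : N.WeightIndex → ℝ) : N.Weights := fun i =>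
  (Matrix.of fun j k => η ⟨i, .inl (j, k)⟩, fun j => η ⟨i, .inr j⟩)

/-- The network function with the weights given as a vector of scalars. -/
noncomputable def net (η : N.WeightIndex → ℝ) (x : EuclideanSpace ℝ (Fin N.inputDim)) : ℝ :=
  N.realize (N.toWeights η) x

/-- With the weights flattened into one vector, the entrywise bound is a sup-norm ball: compact,
convex and easy to cover by a grid. -/
theorem networkClass_eq_image {B : ℝ} (hB : 0 < B) :
    N.networkClass B = N.net '' Metric.closedBall 0 B := by
  ext v
  constructor
  · rintro ⟨θ, hθ, rfl⟩
    refine ⟨fun a => match a with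
      | ⟨i, .inl (j, k)⟩ => (θ i).1 j k
      | ⟨i, .inr j⟩ => (θ i).2 j, ?_, rfl⟩
    rw [mem_closedBall_zero_iff, pi_norm_le_iff_of_nonneg hB.le]
    rintro ⟨i, ⟨j, k⟩ | j⟩
    · exact (hθ i).1 j k
    · exact (hθ i).2 j
  · rintro ⟨η, hη, rfl⟩
    rw [mem_closedBall_zero_iff, pi_norm_le_iff_of_nonneg hB.le] at hη
    exact ⟨N.toWeights η, fun i => ⟨fun j k => hη ⟨i, .inl (j, k)⟩, fun j => hη ⟨i, .inr j⟩⟩, rfl⟩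

theorem contDiff_preact {n : WithTop ℕ∞} (i : ℕ) (hi : i < N.hidden + 1)
    (k : Fin (N.width (i + 1))) :
    ContDiff ℝ n fun z : (N.WeightIndex → ℝ) × EuclideanSpace ℝ (Fin N.inputDim) =>
      N.preact (N.toWeights z.1) z.2 i hi k := by
  have hw : ∀ a : N.WeightIndex, ContDiff ℝ n
      fun z : (N.WeightIndex → ℝ) × EuclideanSpace ℝ (Fin N.inputDim) => z.1 a := fun a =>
    (contDiff_apply ℝ ℝ a).comp contDiff_fst
  induction i with
  | zero =>
    have hx : ∀ j : Fin N.inputDim, ContDiff ℝ n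
        fun z : (N.WeightIndex → ℝ) × EuclideanSpace ℝ (Fin N.inputDim) => z.2 j := fun j =>
      (contDiff_piLp_apply (p := 2)).comp contDiff_snd
    simp only [preact, toWeights, Pi.add_apply, Matrix.mulVec, dotProduct, Matrix.of_apply]
    exact (ContDiff.sum fun j _ => (hw _).mul (hx j)).add (hw _)
  | succ i ih =>
    simp only [preact, Pi.add_apply, Matrix.mulVec, dotProduct]
    exact (ContDiff.sum fun j _ => (hw ⟨⟨i + 1, hi⟩, .inl (k, j)⟩).mul
      (contDiff_swish.comp (ih _ j))).add (hw ⟨⟨i + 1, hi⟩, .inr k⟩)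

theorem contDiff_net {n : WithTop ℕ∞} : ContDiff ℝ n (Function.uncurry N.net) :=
  N.contDiff_preact _ _ _

/-- The gradient is the Riesz representative of the derivative in x, which is jointly smooth;
squaring avoids the singularity of the norm at 0. The order `⊤` is analyticity, so differentiating
loses no regularity. -/
theorem contDiff_norm_gradient_net {n : ℕ∞} :
    ContDiff ℝ n (Function.uncurry fun η x => ‖∇ (N.net η) x‖ ^ 2) := by
  have h : ContDiff ℝ n fun z : (N.WeightIndex → ℝ) × EuclideanSpace ℝ (Fin N.inputDim) =>
      fderiv ℝ (N.net z.1) z.2 :=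
    ContDiff.fderiv (m := ⊤)
      (f := fun (z : (N.WeightIndex → ℝ) × EuclideanSpace ℝ (Fin N.inputDim)) => N.net z.1)
      (N.contDiff_net.comp ((contDiff_fst.comp contDiff_fst).prodMk contDiff_snd)) contDiff_snd
      le_top
  have h' := ((InnerProductSpace.toDual ℝ
    (EuclideanSpace ℝ (Fin N.inputDim))).symm.contDiff.comp h).norm_sq ℝ
  exact h'

end Architecture

/-! ### The cube and uniform sampling. -/

theorem unitCube_eq_preimage (d : ℕ) :
    unitCube d = WithLp.ofLp ⁻¹' Set.Icc (0 : Fin d → ℝ) 1 := by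
  ext x
  simp [unitCube, Pi.le_def, forall_and]

theorem isCompact_unitCube (d : ℕ) : IsCompact (unitCube d) := by
  rw [unitCube_eq_preimage]
  exact (PiLp.homeomorph 2 fun _ : Fin d => ℝ).isCompact_preimage.2 isCompact_Icc

theorem convex_unitCube (d : ℕ) : Convex ℝ (unitCube d) := by
  rw [unitCube_eq_preimage]
  exact (convex_Icc (0 : Fin d → ℝ) 1).linear_preimage
    (WithLp.linearEquiv 2 ℝ (Fin d → ℝ)).toLinearMap

theorem volume_unitCube (d : ℕ) : volume (unitCube d) = 1 := by
  rw [unitCube_eq_preimage, (PiLp.volume_preserving_ofLp (Fin d)).measure_preimage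
    measurableSet_Icc.nullMeasurableSet, Real.volume_Icc_pi]
  simp

instance isProbabilityMeasure_restrict_unitCube (d : ℕ) :
    IsProbabilityMeasure (volume.restrict (unitCube d)) :=
  ⟨by rw [Measure.restrict_apply_univ, volume_unitCube]⟩

theorem IsIIDUniform.map_eq {d n : ℕ} {S : Type*} [MeasurableSpace S] {P : Measure S}
    {X : Fin n → S → EuclideanSpace ℝ (Fin d)} (hX : IsIIDUniform P X) (j : Fin n) :
    P.map (X j) = volume.restrict (unitCube d) := by
  have h : P.map (X j) = ProbabilityTheory.cond volume (unitCube d) := hX.2 j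
  rw [h, ProbabilityTheory.cond, volume_unitCube, inv_one, one_smul]

theorem IsIIDUniform.aemeasurable {d n : ℕ} {S : Type*} [MeasurableSpace S] {P : Measure S}
    {X : Fin n → S → EuclideanSpace ℝ (Fin d)} (hX : IsIIDUniform P X) (j : Fin n) :
    AEMeasurable (X j) P :=
  (hX.2 j).aemeasurable (by simp [volume_unitCube]) (by simp [volume_unitCube])

/-! ### From majorants to expectations. -/

/-- Outer expectation asks for a measurable majorant at every point, so an almost sure one is set to
∞ on a measurable null set, at no cost to its integral. -/
theorem outerExpectation_le {S : Type*} [MeasurableSpace S] {P : Measure S} {h Z : S → ℝ}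
    (hZ : Integrable Z P) (hle : ∀ᵐ ω ∂P, |h ω| ≤ Z ω) :
    outerExpectation P (fun ω => |h ω|) ≤ ENNReal.ofReal (∫ ω, Z ω ∂P) := by
  classical
  have hZm := hZ.aemeasurable.ennreal_ofReal
  have hae : ∀ᵐ ω ∂P, ENNReal.ofReal |h ω| ≤ hZm.mk _ ω := by
    filter_upwards [hle, hZm.ae_eq_mk] with ω h1 h2
    rw [← h2]
    exact ENNReal.ofReal_le_ofReal h1
  obtain ⟨t, hts, htm, ht0⟩ := exists_measurable_superset_of_null (ae_iff.1 hae)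
  let Y : S → ℝ≥0∞ := t.piecewise (fun _ => ⊤) (hZm.mk _)
  have hY : Measurable Y := measurable_const.piecewise htm hZm.measurable_mk
  have hhY : ∀ ω, ENNReal.ofReal |h ω| ≤ Y ω := by
    intro ω
    by_cases hω : ω ∈ t
    · simp [Y, hω]
    · simp only [Y, Set.piecewise_eq_of_notMem _ _ _ hω]
      by_contra hne
      exact hω (hts hne)
  have hZ0 : 0 ≤ᵐ[P] Z := by filter_upwards [hle] with ω hω using (abs_nonneg _).trans hω
  rw [ofReal_integral_eq_lintegral_ofReal hZ hZ0]
  refine le_trans (iInf_le _ Y) (le_trans (iInf_le _ hY) (le_trans (iInf_le _ hhY) (le_of_eq ?_)))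
  refine lintegral_congr_ae ?_
  filter_upwards [measure_eq_zero_iff_ae_notMem.1 ht0, hZm.ae_eq_mk] with ω h1 h2
  simp [Y, h1, ← h2]

theorem exists_isArgmin_image {α β : Type*} [TopologicalSpace β] {s : Set β} (hs : IsCompact s)
    (hne : s.Nonempty) {Φ : β → α} {J : α → ℝ} (hc : ContinuousOn (fun b => J (Φ b)) s) :
    ∃ u, IsArgmin J (Φ '' s) u := by
  obtain ⟨b, hb, hmin⟩ := hs.exists_isMinOn hne hc
  exact ⟨Φ b, Set.mem_image_of_mem _ hb, Set.forall_mem_image.2 fun b' hb' => hmin hb'⟩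

/-- The expectation bounds for a sample-dependent and for a fixed element of a class, given a
uniform integrable majorant of the deviation between a loss and its empirical version. -/
theorem expectation_bounds_of_majorant {α β S : Type*} [MeasurableSpace S] {P : Measure S}
    {s : Set β} {Φ : β → α} {J : α → ℝ} {Jn : S → α → ℝ} {Z : S → ℝ} {c : ℝ}
    (hZ : Integrable Z P) (hle : ∀ᵐ ω ∂P, ∀ b ∈ s, |J (Φ b) - Jn ω (Φ b)| ≤ Z ω)
    (hc : ∫ ω, Z ω ∂P ≤ c) (hm : ∀ b ∈ s, AEMeasurable (fun ω => Jn ω (Φ b)) P) :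
    (∀ un : S → α, (∀ᵐ ω ∂P, IsArgmin (Jn ω) (Φ '' s) (un ω)) →
      outerExpectation P (fun ω => |J (un ω) - Jn ω (un ω)|) ≤ ENNReal.ofReal c) ∧
    (∀ uF, IsArgmin J (Φ '' s) uF → Integrable (fun ω => |J uF - Jn ω uF|) P ∧
      ∫ ω, |J uF - Jn ω uF| ∂P ≤ c) := by
  refine ⟨fun un hun => ?_, ?_⟩
  · refine (outerExpectation_le hZ ?_).trans (ENNReal.ofReal_le_ofReal hc)
    filter_upwards [hle, hun] with ω h1 h2
    obtain ⟨b, hb, hbu⟩ := h2.1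
    rw [← hbu]
    exact h1 b hb
  · rintro uF ⟨⟨b, hb, rfl⟩, -⟩
    have hi : Integrable (fun ω => |J (Φ b) - Jn ω (Φ b)|) P := by
      refine hZ.mono' (((hm b hb).const_sub _).abs).aestronglyMeasurable ?_
      filter_upwards [hle] with ω h1
      simpa using h1 b hb
    refine ⟨hi, (integral_mono_ae hi hZ ?_).trans hc⟩
    filter_upwards [hle] with ω h1 using h1 b hb

/-- Half the square is K-Lipschitz on [-K, K]; this carries deviations of the mean over to the
squared mean in the Poisson loss. -/
theorem abs_half_sq_sub_le {a b K : ℝ} (ha : |a| ≤ K) (hb : |b| ≤ K) :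
    |1 / 2 * a ^ 2 - 1 / 2 * b ^ 2| ≤ K * |a - b| := by
  have e : 1 / 2 * a ^ 2 - 1 / 2 * b ^ 2 = ((a + b) / 2) * (a - b) := by ring
  rw [e, abs_mul]
  refine mul_le_mul_of_nonneg_right ?_ (abs_nonneg _)
  rw [abs_le] at *
  constructor <;> linarith

theorem IsBddLipFamily.aemeasurable_average {ι E S : Type*} [Fintype ι] [MeasurableSpace E]
    [MeasurableSpace S] {μ : Measure E} {R K Λ : ℝ} {h : (ι → ℝ) → E → ℝ}
    (hh : IsBddLipFamily μ R K Λ h) {P : Measure S} {n : ℕ} {X : Fin n → S → E}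
    (hX : ∀ j, AEMeasurable (X j) P) (hlaw : ∀ j, P.map (X j) = μ) (θ : ι → ℝ) :
    AEMeasurable (fun ω => 1 / (n : ℝ) * ∑ j, h θ (X j ω)) P := by
  refine AEMeasurable.const_mul (Finset.aemeasurable_fun_sum _ fun j _ => ?_) _
  have : AEMeasurable (h θ) (P.map (X j)) := by rw [hlaw j]; exact hh.aemeasurable θ
  exact this.comp_aemeasurable (hX j)

/-! ### The loss integrands as bounded Lipschitz families. -/

namespace Architecture

variable (N : Architecture)

theorem continuous_net_left (x : EuclideanSpace ℝ (Fin N.inputDim)) :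
    Continuous fun η => N.net η x :=
  (N.contDiff_net (n := 0)).continuous.comp (Continuous.prodMk_left x)

theorem continuous_norm_gradient_net_left (x : EuclideanSpace ℝ (Fin N.inputDim)) :
    Continuous fun η => ‖∇ (N.net η) x‖ ^ 2 := by
  have h : Continuous (Function.uncurry fun η x => ‖∇ (N.net η) x‖ ^ 2) :=
    (N.contDiff_norm_gradient_net (n := 0)).continuous
  exact h.uncurry_right x

theorem exists_net_family (B : ℝ) :
    ∃ K Λ, IsBddLipFamily (volume.restrict (unitCube N.inputDim)) B K Λ N.net :=
  IsBddLipFamily.of_contDiff (isCompact_unitCube _) (convex_unitCube _) _ B N.contDiff_net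

theorem exists_half_sq_net_family (B : ℝ) :
    ∃ K Λ, IsBddLipFamily (volume.restrict (unitCube N.inputDim)) B K Λ
      fun η x => 1 / 2 * N.net η x ^ 2 :=
  IsBddLipFamily.of_contDiff (isCompact_unitCube _) (convex_unitCube _) _ B
    (contDiff_const.mul (N.contDiff_net.pow 2))

theorem exists_half_norm_gradient_family (B : ℝ) :
    ∃ K Λ, IsBddLipFamily (volume.restrict (unitCube N.inputDim)) B K Λ
      fun η x => 1 / 2 * ‖∇ (N.net η) x‖ ^ 2 :=
  IsBddLipFamily.of_contDiff (isCompact_unitCube _) (convex_unitCube _) _ B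
    (contDiff_const.mul (N.contDiff_norm_gradient_net (n := 1)))

/-- The integrand of the Poisson loss is a bounded Lipschitz family, with constants that depend on
the right-hand side only through its bound. -/
theorem exists_poisson_family (B M : ℝ) : ∃ K Λ, 0 ≤ Λ ∧
    ∀ f : EuclideanSpace ℝ (Fin N.inputDim) → ℝ,
      AEMeasurable f (volume.restrict (unitCube N.inputDim)) →
      (∀ᵐ x ∂(volume.restrict (unitCube N.inputDim)), |f x| ≤ M) →
      IsBddLipFamily (volume.restrict (unitCube N.inputDim)) B K Λ
        fun η x => 1 / 2 * ‖∇ (N.net η) x‖ ^ 2 - f x * N.net η x := by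
  obtain ⟨K₁, Λ₁, h₁⟩ := N.exists_half_norm_gradient_family B
  obtain ⟨K₂, Λ₂, h₂⟩ := N.exists_net_family B
  -- The absolute value keeps the bound nonnegative for every M; `0 * K₂` is the product rule's term
  -- for the fixed factor f.
  refine ⟨K₁ + |M| * K₂, Λ₁ + (|M| * Λ₂ + 0 * K₂), ?_, fun f hf hM => ?_⟩
  · have := h₁.lip_nonneg
    have := h₂.lip_nonneg
    rw [zero_mul, add_zero]
    positivity
  · have hφ : IsBddLipFamily (volume.restrict (unitCube N.inputDim)) B |M| 0
        (fun (_ : N.WeightIndex → ℝ) x => -f x) :=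
      .of_fixed (abs_nonneg M) hf.neg (by
        filter_upwards [hM] with x hx
        rw [abs_neg]
        exact hx.trans (le_abs_self M))
    have := h₁.add (hφ.mul h₂)
    simpa only [neg_mul, ← sub_eq_add_neg] using this

/-- The integrand of the Schrödinger loss is a bounded Lipschitz family, with constants that depend
on the coefficients only through their bounds. -/
theorem exists_schrodinger_family (B M Vmin Vmax : ℝ) (hV : 0 < Vmin) : ∃ K Λ, 0 ≤ Λ ∧
    ∀ V g : EuclideanSpace ℝ (Fin N.inputDim) → ℝ,
      AEMeasurable V (volume.restrict (unitCube N.inputDim)) →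
      (∀ᵐ x ∂(volume.restrict (unitCube N.inputDim)), Vmin ≤ V x ∧ V x ≤ Vmax) →
      AEMeasurable g (volume.restrict (unitCube N.inputDim)) →
      (∀ᵐ x ∂(volume.restrict (unitCube N.inputDim)), |g x| ≤ M) →
      IsBddLipFamily (volume.restrict (unitCube N.inputDim)) B K Λ
        fun η x => 1 / 2 * ‖∇ (N.net η) x‖ ^ 2 + 1 / 2 * V x * |N.net η x| ^ 2
          - g x * N.net η x := by
  -- The Schrödinger integrand is the Poisson one with f = g, plus V times half the squared network.
  obtain ⟨K₁, Λ₁, hΛ₁, h₁⟩ := N.exists_poisson_family B M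
  obtain ⟨K₂, Λ₂, h₂⟩ := N.exists_half_sq_net_family B
  refine ⟨K₁ + |Vmax| * K₂, Λ₁ + (|Vmax| * Λ₂ + 0 * K₂), ?_, fun V g hVm hVb hg hM => ?_⟩
  · have := h₂.lip_nonneg
    rw [zero_mul, add_zero]
    positivity
  · have hφ : IsBddLipFamily (volume.restrict (unitCube N.inputDim)) B |Vmax| 0
        (fun (_ : N.WeightIndex → ℝ) x => V x) :=
      .of_fixed (abs_nonneg Vmax) hVm (by
        filter_upwards [hVb] with x hx
        rw [abs_of_nonneg (hV.le.trans hx.1)]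
        exact hx.2.trans (le_abs_self Vmax))
    have := (h₁ g hg hM).add (hφ.mul h₂)
    convert this using 3
    rw [sq_abs]
    ring

end Architecture

/-! ### The generalization bounds. -/

theorem theorem3p1 (N : Architecture) (B : ℝ) (hB : 0 < B) :
    (∀ M : ℝ, ∃ lam : ℝ, 0 < lam ∧
      ∀ f : EuclideanSpace ℝ (Fin N.inputDim) → ℝ,
        MemLp f 2 (volume.restrict (unitCube N.inputDim)) →
        ∫ x in unitCube N.inputDim, f x = 0 →
        (∀ᵐ x ∂(volume.restrict (unitCube N.inputDim)), |f x| ≤ M) →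
        (∃ uF, IsArgmin (poissonLoss f) (N.networkClass B) uF) ∧
        ∀ n : ℕ, 2 ≤ n →
          (∀ x : Fin n → EuclideanSpace ℝ (Fin N.inputDim),
            ∃ un, IsArgmin (poissonEmpLoss f x) (N.networkClass B) un) ∧
          ∀ (S : Type u) [MeasurableSpace S] (P : Measure S) [IsProbabilityMeasure P]
            (X : Fin n → S → EuclideanSpace ℝ (Fin N.inputDim)), IsIIDUniform P X →
            (∀ un : S → EuclideanSpace ℝ (Fin N.inputDim) → ℝ,
              (∀ᵐ ω ∂P, IsArgmin (poissonEmpLoss f (fun j => X j ω)) (N.networkClass B) (un ω)) →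
              outerExpectation P
                  (fun ω => |poissonLoss f (un ω) - poissonEmpLoss f (fun j => X j ω) (un ω)|)
                ≤ ENNReal.ofReal
                  (lam * (n : ℝ) ^ (-(1 / 2) : ℝ) * Real.log n ^ (1 / 2 : ℝ))) ∧
            (∀ uF : EuclideanSpace ℝ (Fin N.inputDim) → ℝ,
              IsArgmin (poissonLoss f) (N.networkClass B) uF →
              Integrable
                  (fun ω => |poissonLoss f uF - poissonEmpLoss f (fun j => X j ω) uF|) P ∧
              ∫ ω, |poissonLoss f uF - poissonEmpLoss f (fun j => X j ω) uF| ∂P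
                ≤ lam * (n : ℝ) ^ (-(1 / 2) : ℝ) * Real.log n ^ (1 / 2 : ℝ))) ∧
    (∀ M Vmin Vmax : ℝ, 0 < Vmin → ∃ lam : ℝ, 0 < lam ∧
      ∀ V g : EuclideanSpace ℝ (Fin N.inputDim) → ℝ,
        MemLp V ∞ (volume.restrict (unitCube N.inputDim)) →
        (∀ᵐ x ∂(volume.restrict (unitCube N.inputDim)), Vmin ≤ V x ∧ V x ≤ Vmax) →
        MemLp g ∞ (volume.restrict (unitCube N.inputDim)) →
        (∀ᵐ x ∂(volume.restrict (unitCube N.inputDim)), |g x| ≤ M) →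
        (∃ uF, IsArgmin (schrodingerLoss V g) (N.networkClass B) uF) ∧
        ∀ n : ℕ, 2 ≤ n →
          (∀ x : Fin n → EuclideanSpace ℝ (Fin N.inputDim),
            ∃ un, IsArgmin (schrodingerEmpLoss V g x) (N.networkClass B) un) ∧
          ∀ (S : Type u) [MeasurableSpace S] (P : Measure S) [IsProbabilityMeasure P]
            (X : Fin n → S → EuclideanSpace ℝ (Fin N.inputDim)), IsIIDUniform P X →
            (∀ un : S → EuclideanSpace ℝ (Fin N.inputDim) → ℝ,
              (∀ᵐ ω ∂P,
                IsArgmin (schrodingerEmpLoss V g (fun j => X j ω)) (N.networkClass B) (un ω)) →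
              outerExpectation P
                  (fun ω => |schrodingerLoss V g (un ω)
                    - schrodingerEmpLoss V g (fun j => X j ω) (un ω)|)
                ≤ ENNReal.ofReal
                  (lam * (n : ℝ) ^ (-(1 / 2) : ℝ) * Real.log n ^ (1 / 2 : ℝ))) ∧
            (∀ uF : EuclideanSpace ℝ (Fin N.inputDim) → ℝ,
              IsArgmin (schrodingerLoss V g) (N.networkClass B) uF →
              Integrable
                  (fun ω => |schrodingerLoss V g uF
                    - schrodingerEmpLoss V g (fun j => X j ω) uF|) P ∧
              ∫ ω, |schrodingerLoss V g uF - schrodingerEmpLoss V g (fun j => X j ω) uF| ∂P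
                ≤ lam * (n : ℝ) ^ (-(1 / 2) : ℝ) * Real.log n ^ (1 / 2 : ℝ))) := by
  have hcpt : IsCompact (Metric.closedBall (0 : N.WeightIndex → ℝ) B) := isCompact_closedBall _ _
  have hne : (Metric.closedBall (0 : N.WeightIndex → ℝ) B).Nonempty :=
    ⟨0, Metric.mem_closedBall_self hB.le⟩
  rw [N.networkClass_eq_image hB]
  constructor
  · intro M
    obtain ⟨K₁, Λ₁, hΛ₁, hfam⟩ := N.exists_poisson_family B M
    obtain ⟨K₂, Λ₂, h₂⟩ := N.exists_net_family B
    have hK₂ := h₂.bound_nonneg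
    have hΛ₂ := h₂.lip_nonneg
    set c₁ : ℝ := 4 * Λ₁ * B + (1 + 2 * Fintype.card N.WeightIndex + K₁ ^ 2 / 2) with hc₁
    set c₂ : ℝ := 4 * Λ₂ * B + (1 + 2 * Fintype.card N.WeightIndex + K₂ ^ 2 / 2) with hc₂
    refine ⟨c₁ + K₂ * c₂, by positivity, fun f hf _ hM => ?_⟩
    have h₁ := hfam f hf.aestronglyMeasurable.aemeasurable hM
    refine ⟨exists_isArgmin_image hcpt hne ?_, fun n hn => ⟨fun x =>
      exists_isArgmin_image hcpt hne (Continuous.continuousOn ?_), ?_⟩⟩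
    · exact h₁.continuousOn_integral.add (continuousOn_const.mul (h₂.continuousOn_integral.pow 2))
    -- At a fixed sample the values of f are mere constants, so continuity in the weights holds for
    -- every sample, without exceptional sets.
    · unfold poissonEmpLoss
      have a := N.continuous_net_left
      have b := N.continuous_norm_gradient_net_left
      fun_prop
    intro S _ P _ X hX
    obtain ⟨Z₁, hZ₁, hle₁, hint₁⟩ := h₁.exists_majorant hB hn hX.1 hX.aemeasurable hX.map_eq
    obtain ⟨Z₂, hZ₂, hle₂, hint₂⟩ := h₂.exists_majorant hB hn hX.1 hX.aemeasurable hX.map_eq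
    refine expectation_bounds_of_majorant (J := poissonLoss f)
      (Jn := fun ω => poissonEmpLoss f fun j => X j ω) (hZ₁.add (hZ₂.const_mul K₂)) ?_ ?_ ?_
    -- The bound K₂ is needed for the empirical mean as well, before the squares can be compared.
    · have hbd : ∀ᵐ ω ∂P, ∀ j, ∀ θ ∈ Metric.closedBall 0 B, |N.net θ (X j ω)| ≤ K₂ :=
        ae_all_iff.2 fun j => ae_of_ae_map (hX.aemeasurable j) (by
          rw [hX.map_eq j]; exact h₂.ae_bound)
      filter_upwards [hle₁, hle₂, hbd] with ω e₁ e₂ e₃ θ hθ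
      have e₄ := abs_half_sq_sub_le (h₂.abs_integral_le hθ)
        (abs_average_le (by omega : 0 < n) fun j => e₃ j θ hθ)
      unfold poissonLoss poissonEmpLoss
      rw [add_sub_add_comm]
      refine (abs_add_le _ _).trans (add_le_add (e₁ θ hθ) (e₄.trans ?_))
      exact mul_le_mul_of_nonneg_left (e₂ θ hθ) hK₂
    · rw [integral_add' hZ₁ (hZ₂.const_mul K₂), integral_const_mul, mul_assoc]
      change _ ≤ (c₁ + K₂ * c₂) * logRate n
      rw [← hc₁] at hint₁
      rw [← hc₂] at hint₂
      have := mul_le_mul_of_nonneg_left hint₂ hK₂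
      linarith
    · exact fun θ _ => (h₁.aemeasurable_average hX.aemeasurable hX.map_eq θ).add
        (((h₂.aemeasurable_average hX.aemeasurable hX.map_eq θ).pow_const 2).const_mul _)
  · intro M Vmin Vmax hV
    obtain ⟨K, Λ, hΛ, hfam⟩ := N.exists_schrodinger_family B M Vmin Vmax hV
    refine ⟨4 * Λ * B + (1 + 2 * Fintype.card N.WeightIndex + K ^ 2 / 2), by positivity,
      fun V g hVm hVb hg hM => ?_⟩
    have h := hfam V g hVm.aestronglyMeasurable.aemeasurable hVb
      hg.aestronglyMeasurable.aemeasurable hM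
    refine ⟨exists_isArgmin_image hcpt hne h.continuousOn_integral, fun n hn => ⟨fun x =>
      exists_isArgmin_image hcpt hne (Continuous.continuousOn ?_), ?_⟩⟩
    · unfold schrodingerEmpLoss
      have a := N.continuous_net_left
      have b := N.continuous_norm_gradient_net_left
      fun_prop
    intro S _ P _ X hX
    obtain ⟨Z, hZ, hle, hint⟩ := h.exists_majorant hB hn hX.1 hX.aemeasurable hX.map_eq
    refine expectation_bounds_of_majorant (J := schrodingerLoss V g)
      (Jn := fun ω => schrodingerEmpLoss V g fun j => X j ω) hZ ?_ ?_ ?_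
    · filter_upwards [hle] with ω e θ hθ
      have := e θ hθ
      simp only [add_sub_right_comm] at this
      simpa only [schrodingerLoss, schrodingerEmpLoss, add_sub_right_comm] using this
    · rw [mul_assoc]
      exact hint
    · intro θ _
      simpa only [schrodingerEmpLoss, add_sub_right_comm] using
        h.aemeasurable_average hX.aemeasurable hX.map_eq θ
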